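/- Let $P$ be a finite nonempty partially ordered set, let $K$ be a field, and let $S=K[\{x_p,y_p\}_{p\in P}]$ be the polynomial ring in $2|P|$ variables, with every variable of degree $1$. For a poset ideal $I$ of $P$ (a subset $I\subseteq P$ such that $q\in I$ and $p\le q$ imply $p\in I$) put $u_I=\prod_{p\in I}x_p\cdot\prod_{p\in P\setminus I}y_p$, and let $H_P\subseteq S$ be the ideal generated by all $u_I$, where $I$ runs over the poset ideals of $P$ (including $\emptyset$ and $P$). Then: 1. $H_P$ has height $2$; 2. for all $p\le q$ in $P$ the ideal $(x_p,y_q)$ is prime, and $$H_P=\bigcap_{p,q\in P,\ p\le q}(x_p,y_q);$$ 3. the multiplicity of $S/H_P$ is $$e(S/H_P)=|\{(p,q) : p,q\in P,\ p\le q\}|.$$ Here, if $d$ is the Krull dimension of $S/H_P$, then its Hilbert series is $\sum_{k\ge 0}\dim_K(S/H_P)_k\,t^k=Q(t)/(1-t)^d$ for a polynomial $Q\in\mathbb{Z}[t]$, and $e(S/H_P)=Q(1)$. -/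

import Mathlib

noncomputable section

namespace PosetIdeal

open MvPolynomial

/-- The Hilbert function of `S / I`, where `S = K[X_s : s ∈ σ]` is standard graded and `I` is a
graded ideal: its value at `k` is the `K`-dimension of the degree `k` component of `S / I`, which is
the image in `S / I` of the space of homogeneous polynomials of degree `k`. -/
def hilbertFunction {σ K : Type*} [Field K] (I : Ideal (MvPolynomial σ K)) (k : ℕ) : ℕ :=
  Module.finrank K
    ((homogeneousSubmodule σ K k).map (Ideal.Quotient.mkₐ K I).toLinearMap)

/-- The Hilbert series `∑ₖ dim_K (S / I)_k tᵏ` of `S / I`. -/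
def hilbertSeries {σ K : Type*} [Field K] (I : Ideal (MvPolynomial σ K)) : PowerSeries ℤ :=
  PowerSeries.mk fun k => (hilbertFunction I k : ℤ)

/-- `IsMultiplicity I e` says that `S / I` has multiplicity `e`: if `d` is the Krull dimension of
`S / I`, then the Hilbert series of `S / I` is `Q(t) / (1 - t) ^ d` for a polynomial `Q` with integer
coefficients, and `e = Q(1)`. (For `d = 0` this is the length of `S / I`, and for `d > 0` it is
`(d - 1)!` times the coefficient of degree `d - 1` of the Hilbert polynomial.) -/
def IsMultiplicity {σ K : Type*} [Field K] (I : Ideal (MvPolynomial σ K)) (e : ℤ) : Prop :=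
  ∃ (d : ℕ) (Q : Polynomial ℤ),
    ringKrullDim (MvPolynomial σ K ⧸ I) = d ∧
    hilbertSeries I * (1 - PowerSeries.X) ^ d = (Q : PowerSeries ℤ) ∧
    Q.eval 1 = e

/-- The multiplicity is unique. -/
theorem IsMultiplicity.unique {σ K : Type*} [Field K] {I : Ideal (MvPolynomial σ K)} {e e' : ℤ}
    (h : IsMultiplicity I e) (h' : IsMultiplicity I e') : e = e' := by
  obtain ⟨d, Q, hd, hQ, rfl⟩ := h
  obtain ⟨d', Q', hd', hQ', rfl⟩ := h'
  have hdd : d = d' := by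
    rw [hd] at hd'
    exact_mod_cast hd'
  subst hdd
  rw [hQ] at hQ'
  rw [Polynomial.coe_injective ℤ hQ']

/-- The variable `x_p` of the polynomial ring `S = K[{x_p, y_p}_{p ∈ P}]`. -/
def x {P : Type*} (K : Type*) [Field K] (p : P) : MvPolynomial (P ⊕ P) K := X (Sum.inl p)

/-- The variable `y_p` of the polynomial ring `S = K[{x_p, y_p}_{p ∈ P}]`. -/
def y {P : Type*} (K : Type*) [Field K] (p : P) : MvPolynomial (P ⊕ P) K := X (Sum.inr p)

open Classical in
/-- The monomial `u_I = (∏_{p ∈ I} x_p) (∏_{p ∈ P \ I} y_p)` of a poset ideal (lower set) `I`. -/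
def u {P : Type*} [PartialOrder P] [Fintype P] (K : Type*) [Field K] (I : LowerSet P) :
    MvPolynomial (P ⊕ P) K :=
  (∏ p : P with p ∈ I, x K p) * ∏ p : P with p ∉ I, y K p

/-- The ideal `H_P` generated by all `u_I`, where `I` runs over the poset ideals of `P`. -/
def H (P : Type*) [PartialOrder P] [Fintype P] (K : Type*) [Field K] :
    Ideal (MvPolynomial (P ⊕ P) K) :=
  Ideal.span (Set.range fun I : LowerSet P => u K I)

end PosetIdeal

end

/-! A monomial divisible by `x_p` or `y_q` for every `p ≤ q` is divisible by `u_I`, where `I` is the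
lower closure of the `q` with `y_q` absent. As the ideals involved are monomial, this gives the
intersection formula `H_eq_iInf`. It is a finite intersection, so every prime over `H_P` contains
some `(x_p, y_q)`, whence height `2` and dimension `n = 2|P| - 2`.

For the multiplicity, `mem_H_iff` says that the monomials outside `H_P` are those whose support is a
face, i.e. avoids some pair `x_p, y_q` with `p ≤ q`. Hence the Hilbert series is the sum of
`(t/(1-t))^|s|` over faces `s`. After multiplication by `(1-t)^n`, only faces of size `n` survive at
`t = 1`, and these are the complements of the pairs (`card_facets`). -/

namespace PosetIdeal

open MvPolynomial

/-! ### Ideals generated by variables -/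

section VariableIdeals

variable {σ K : Type*} [Field K]

/-- An ideal generated by variables is the kernel of the map setting these variables to zero. -/
theorem ker_killCompl_compl (s : Set σ) :
    RingHom.ker (killCompl (R := K) (Subtype.val_injective (p := (· ∈ sᶜ)))) =
      Ideal.span (X '' s) := by
  set f := killCompl (R := K) (Subtype.val_injective (p := (· ∈ sᶜ))) with hf
  have hX : ∀ i ∈ s, f (X i) = 0 := fun i hi => by
    simp only [hf, killCompl, aeval_X]
    rw [dif_neg]
    simpa using hi
  apply le_antisymm
  · intro p hp
    -- Killing the variables in `s` and including the result back changes nothing modulo these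
    -- variables.
    have key : (Ideal.Quotient.mkₐ K (Ideal.span (X '' s))).comp
        ((rename (Subtype.val : {i // i ∈ sᶜ} → σ)).comp f) =
        Ideal.Quotient.mkₐ K (Ideal.span (X '' s)) := by
      ext i
      by_cases hi : i ∈ s
      · simp only [AlgHom.comp_apply, hX i hi, map_zero]
        symm
        exact Ideal.Quotient.eq_zero_iff_mem.2 (Ideal.subset_span ⟨i, hi, rfl⟩)
      · have : f (X i) = X ⟨i, hi⟩ := by
          have := killCompl_rename_app (R := K) (Subtype.val_injective (p := (· ∈ sᶜ))) (X ⟨i, hi⟩)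
          rwa [rename_X] at this
        simp [this]
    have h := AlgHom.congr_fun key p
    rw [RingHom.mem_ker] at hp
    simp only [AlgHom.comp_apply, hp, map_zero] at h
    exact Ideal.Quotient.eq_zero_iff_mem.1 h.symm
  · rw [Ideal.span_le]
    rintro _ ⟨i, hi, rfl⟩
    exact hX i hi

theorem killCompl_surjective {τ : Type*} {g : τ → σ} (hg : Function.Injective g) :
    Function.Surjective (killCompl (R := K) hg) :=
  fun p => ⟨rename g p, killCompl_rename_app hg p⟩

theorem isPrime_span_X_image (s : Set σ) :
    (Ideal.span (X '' s : Set (MvPolynomial σ K))).IsPrime := by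
  rw [← ker_killCompl_compl]
  exact RingHom.ker_isPrime _

theorem ringKrullDim_quotient_span_X_image [Finite σ] (s : Set σ) :
    ringKrullDim (MvPolynomial σ K ⧸ Ideal.span (X '' s : Set (MvPolynomial σ K))) =
      Nat.card (sᶜ : Set σ) := by
  rw [← ker_killCompl_compl, ringKrullDim_eq_of_ringEquiv
    (Ideal.quotientKerAlgEquivOfSurjective (killCompl_surjective _)).toRingEquiv,
    MvPolynomial.ringKrullDim_of_isNoetherianRing, ringKrullDim_eq_zero_of_field, zero_add]

theorem mem_span_X_image_singleton {i : σ} {j : σ} :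
    (X j : MvPolynomial σ K) ∈ Ideal.span {X i} ↔ j = i := by
  rw [Ideal.mem_span_singleton, X_dvd_X]
  exact eq_comm

/-- An ideal generated by two distinct variables has height two. -/
theorem height_span_pair_X [Finite σ] {i j : σ} (hij : i ≠ j) :
    (Ideal.span {X i, X j} : Ideal (MvPolynomial σ K)).height = 2 := by
  classical
  have h2 : (Ideal.span {X i, X j} : Ideal (MvPolynomial σ K)).IsPrime := by
    simpa [Set.image_pair] using isPrime_span_X_image (K := K) ({i, j} : Set σ)
  have h1 : (Ideal.span {X i} : Ideal (MvPolynomial σ K)).IsPrime := by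
    simpa using isPrime_span_X_image (K := K) ({i} : Set σ)
  apply le_antisymm
  · have := Ideal.height_le_card_of_mem_minimalPrimes_span_finset
      (s := {X i, X j}) (p := (Ideal.span {X i, X j} : Ideal (MvPolynomial σ K)))
      (by simp [Ideal.minimalPrimes_eq_subsingleton_self])
    refine this.trans ?_
    exact_mod_cast Finset.card_le_two
  · have a : (⊥ : Ideal (MvPolynomial σ K)) < Ideal.span {X i} := by
      rw [bot_lt_iff_ne_bot, Ne, Ideal.span_singleton_eq_bot]
      exact X_ne_zero i
    have b : (Ideal.span {X i} : Ideal (MvPolynomial σ K)) < Ideal.span {X i, X j} := by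
      refine lt_of_le_of_ne (Ideal.span_mono (by simp)) fun h => hij ?_
      have : (X j : MvPolynomial σ K) ∈ Ideal.span {X i} := by
        rw [h]; exact Ideal.subset_span (by simp)
      exact (mem_span_X_image_singleton.1 this).symm
    have ha := Ideal.height_add_one_le_of_lt_of_isPrime a
    have hb := Ideal.height_add_one_le_of_lt_of_isPrime b
    rw [Ideal.height_bot] at ha
    calc (2 : ℕ∞) = 0 + 1 + 1 := by norm_num
      _ ≤ _ := by gcongr
      _ ≤ _ := hb

end VariableIdeals

/-! ### Primes over a finite intersection, and Krull dimension -/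

section Intersection

variable {R : Type*} [CommRing R]

theorem exists_le_of_iInf_le {ι : Type*} [Finite ι] {f : ι → Ideal R} {J : Ideal R}
    (hJ : J.IsPrime) (h : ⨅ i, f i ≤ J) : ∃ i, f i ≤ J := by
  cases nonempty_fintype ι
  rw [← Finset.inf_univ_eq_iInf, hJ.inf_le'] at h
  obtain ⟨i, -, hi⟩ := h
  exact ⟨i, hi⟩

/-- The Krull dimension modulo `I` is bounded by the Krull dimension modulo the members of a family
of ideals such that every prime above `I` contains a member of it. -/
theorem ringKrullDim_quotient_le_of_forall_prime {ι : Type*} {I : Ideal R} {J : ι → Ideal R}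
    {N : WithBot ℕ∞} (hI : ∀ p : Ideal R, p.IsPrime → I ≤ p → ∃ i, J i ≤ p)
    (hJ : ∀ i, ringKrullDim (R ⧸ J i) ≤ N) : ringKrullDim (R ⧸ I) ≤ N := by
  rw [ringKrullDim_quotient]
  refine iSup_le fun l => ?_
  obtain ⟨i, hi⟩ := hI l.head.1.asIdeal l.head.1.isPrime l.head.2
  refine le_trans ?_ (hJ i)
  rw [ringKrullDim_quotient]
  -- The whole chain lies above `J i`, because its smallest prime does.
  let l' : LTSeries (PrimeSpectrum.zeroLocus (J i : Set R)) :=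
    { length := l.length
      toFun := fun k => ⟨(l k).1, hi.trans (show l.head.1 ≤ (l k).1 from l.head_le k)⟩
      step := fun k => l.step k }
  exact Order.LTSeries.length_le_krullDim l'

end Intersection

/-! ### Hilbert series of squarefree monomial quotients -/

section HilbertSeries

variable {σ K : Type*} [Fintype σ] [DecidableEq σ] [Field K]

/-- The Hilbert function of `S / I`, where `I` is spanned by the monomials whose support is not in
`B`, counts the monomials with support in `B`. -/
theorem hilbertFunction_eq_card {I : Ideal (MvPolynomial σ K)} {B : Finset (Finset σ)}
    (hI : ∀ m, m ∈ I ↔ ∀ d ∈ m.support, d.support ∉ B) (k : ℕ) :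
    hilbertFunction I k =
      ((Finset.univ.finsuppAntidiag k).filter fun d : σ →₀ ℕ => d.support ∈ B).card := by
  set T := (Finset.univ.finsuppAntidiag k).filter fun d : σ →₀ ℕ => d.support ∈ B with hT
  have hmemT (d : σ →₀ ℕ) : d ∈ T ↔ d.degree = k ∧ d.support ∈ B := by
    simp [hT, Finset.mem_finsuppAntidiag, Finsupp.degree_eq_sum]
  let φ := (Ideal.Quotient.mkₐ K I).toLinearMap
  have hφ (m) : φ m = 0 ↔ m ∈ I := Ideal.Quotient.eq_zero_iff_mem
  let b : T → MvPolynomial σ K ⧸ I := fun d => φ (monomial d.1 1)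
  have hspan : (homogeneousSubmodule σ K k).map φ = Submodule.span K (Set.range b) := by
    apply le_antisymm
    · rw [Submodule.map_le_iff_le_comap]
      intro m hm
      rw [Submodule.mem_comap, m.as_sum, map_sum]
      refine Submodule.sum_mem _ fun d hd => ?_
      have hdk : d.degree = k := by
        rw [mem_homogeneousSubmodule] at hm
        simpa [Finsupp.degree_eq_weight_one, Pi.one_def] using hm (mem_support_iff.1 hd)
      have : monomial d (coeff d m) = coeff d m • monomial d (1 : K) := by
        rw [smul_monomial, smul_eq_mul, mul_one]
      rw [this, map_smul]
      refine Submodule.smul_mem _ _ ?_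
      by_cases hB : d.support ∈ B
      · exact Submodule.subset_span ⟨⟨d, (hmemT d).2 ⟨hdk, hB⟩⟩, rfl⟩
      · rw [(hφ _).2]
        · exact Submodule.zero_mem _
        · rw [hI]
          intro e he
          rwa [Finset.mem_singleton.1 (support_monomial_subset he)]
    · rw [Submodule.span_le]
      rintro _ ⟨d, rfl⟩
      refine Submodule.mem_map_of_mem ?_
      rw [mem_homogeneousSubmodule]
      exact isHomogeneous_monomial _ ((hmemT d).1 d.2).1
  have hli : LinearIndependent K b := by
    rw [Fintype.linearIndependent_iff]
    intro g hg d
    have h0 : ∑ e : T, g e • b e = φ (∑ e : T, monomial e.1 (g e)) := by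
      rw [map_sum]
      refine Finset.sum_congr rfl fun e _ => ?_
      rw [← map_smul, smul_monomial, smul_eq_mul, mul_one]
    rw [h0, hφ, hI] at hg
    by_contra hd
    refine hg d.1 ?_ ((hmemT d).1 d.2).2
    rw [mem_support_iff, coeff_sum, Finset.sum_eq_single d]
    · simpa using hd
    · intro e _ hed
      rw [coeff_monomial, if_neg fun h => hed (Subtype.ext h)]
    · simp
  change Module.finrank K ((homogeneousSubmodule σ K k).map φ) = _
  rw [hspan, finrank_span_eq_card hli, Fintype.card_coe]

/-- The series `t + t² + t³ + ⋯`. -/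
def positiveGeom : PowerSeries ℤ := PowerSeries.mk fun k => if k = 0 then 0 else 1

theorem positiveGeom_mul : positiveGeom * (1 - PowerSeries.X) = PowerSeries.X := by
  ext k
  rcases k with _ | k
  · simp [positiveGeom, mul_sub]
  · rw [mul_sub, mul_one, map_sub, PowerSeries.coeff_succ_mul_X, PowerSeries.coeff_X]
    rcases k with _ | k <;> simp [positiveGeom]

/-- Each element of `s` contributes a factor whose exponent of `t` is the positive exponent of that
variable. -/
theorem coeff_positiveGeom_pow (s : Finset σ) (k : ℕ) :
    PowerSeries.coeff k (positiveGeom ^ s.card) =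
      (((Finset.univ.finsuppAntidiag k).filter fun d : σ →₀ ℕ => d.support = s).card : ℤ) := by
  rw [← Finset.prod_const, PowerSeries.coeff_prod, Finset.card_filter, Nat.cast_sum]
  refine Finset.sum_subset_zero_on_sdiff (Finset.finsuppAntidiag_mono (Finset.subset_univ s) k)
    ?_ ?_
  · intro d hd
    rw [Finset.mem_sdiff, Finset.mem_finsuppAntidiag, Finset.mem_finsuppAntidiag] at hd
    rw [if_neg, Nat.cast_zero]
    rintro rfl
    refine hd.2 ⟨?_, le_rfl⟩
    rw [← hd.1.1]
    exact Finset.sum_subset (Finset.subset_univ _) (by simp)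
  · intro d hd
    rw [Finset.mem_finsuppAntidiag] at hd
    simp only [positiveGeom, PowerSeries.coeff_mk]
    -- If the support is strictly smaller than `s`, some factor is the constant coefficient of
    -- `positiveGeom`, which is zero.
    split_ifs with h
    · rw [Nat.cast_one]
      refine Finset.prod_eq_one fun i hi => if_neg ?_
      rwa [← h, Finsupp.mem_support_iff] at hi
    · rw [Nat.cast_zero]
      obtain ⟨i, hi, hi'⟩ : ∃ i ∈ s, i ∉ d.support := by
        by_contra! hc
        exact h (le_antisymm hd.2 hc)
      exact Finset.prod_eq_zero hi (if_pos (by simpa using hi'))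

/-- Group the surviving monomials by their support. -/
theorem hilbertSeries_eq_sum {I : Ideal (MvPolynomial σ K)} {B : Finset (Finset σ)}
    (hI : ∀ m, m ∈ I ↔ ∀ d ∈ m.support, d.support ∉ B) :
    hilbertSeries I = ∑ s ∈ B, positiveGeom ^ s.card := by
  ext k
  rw [map_sum, hilbertSeries, PowerSeries.coeff_mk, hilbertFunction_eq_card hI,
    Finset.card_eq_sum_card_fiberwise (f := Finsupp.support) (t := B), Nat.cast_sum]
  · refine Finset.sum_congr rfl fun s hs => ?_
    rw [coeff_positiveGeom_pow, Finset.filter_filter]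
    congr 2
    refine Finset.filter_congr fun d _ => ?_
    exact ⟨fun h => h.2, fun h => ⟨h ▸ hs, h⟩⟩
  · intro d hd
    simpa using (Finset.mem_filter.1 (Finset.mem_coe.1 hd)).2

/-- The multiplicity of a Stanley-Reisner ring is the number of faces of maximal size. -/
theorem isMultiplicity_card {I : Ideal (MvPolynomial σ K)} {B : Finset (Finset σ)} {n : ℕ}
    (hI : ∀ m, m ∈ I ↔ ∀ d ∈ m.support, d.support ∉ B) (hB : ∀ s ∈ B, s.card ≤ n)
    (hdim : ringKrullDim (MvPolynomial σ K ⧸ I) = n) :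
    IsMultiplicity I (B.filter fun s => s.card = n).card := by
  -- Each summand is `(t/(1-t))^|s| * (1-t)^n` with the denominator cleared; `|s| ≤ n` makes it a
  -- polynomial.
  refine ⟨n, ∑ s ∈ B, Polynomial.X ^ s.card * (1 - Polynomial.X) ^ (n - s.card), hdim, ?_, ?_⟩
  · rw [hilbertSeries_eq_sum hI, Finset.sum_mul,
      ← Polynomial.coeToPowerSeries.ringHom_apply, map_sum]
    refine Finset.sum_congr rfl fun s hs => ?_
    obtain ⟨c, rfl⟩ := Nat.exists_eq_add_of_le (hB s hs)
    rw [pow_add, ← mul_assoc, ← mul_pow, positiveGeom_mul]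
    simp
  · rw [Polynomial.eval_finsetSum, Finset.card_filter, Nat.cast_sum]
    refine Finset.sum_congr rfl fun s hs => ?_
    have := hB s hs
    simp only [Polynomial.eval_mul, Polynomial.eval_pow, Polynomial.eval_X, one_pow, one_mul,
      Polynomial.eval_sub, Polynomial.eval_one, sub_self]
    split_ifs with h
    · simp [h]
    · rw [zero_pow (by omega), Nat.cast_zero]

end HilbertSeries

/-! ### The ideal `H_P`: decomposition, height, dimension and facets -/

section PosetIdeal

variable {P : Type*} {K : Type*} [Field K]

theorem span_x_y_eq (p q : P) : Ideal.span {x K p, y K q} =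
    Ideal.span (X '' ({Sum.inl p, Sum.inr q} : Set (P ⊕ P)) : Set (MvPolynomial (P ⊕ P) K)) := by
  rw [Set.image_pair]; rfl

theorem mem_span_x_y {p q : P} {m : MvPolynomial (P ⊕ P) K} :
    m ∈ Ideal.span {x K p, y K q} ↔
      ∀ d ∈ m.support, d (Sum.inl p) ≠ 0 ∨ d (Sum.inr q) ≠ 0 := by
  rw [span_x_y_eq, mem_ideal_span_X_image]
  simp

theorem card_compl_pair [Fintype P] (p q : P) :
    Nat.card (({Sum.inl p, Sum.inr q} : Set (P ⊕ P))ᶜ : Set (P ⊕ P)) = 2 * Fintype.card P - 2 := by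
  rw [Nat.card_coe_set_eq, Set.ncard_compl, Set.ncard_pair Sum.inl_ne_inr,
    Nat.card_eq_fintype_card, Fintype.card_sum, two_mul]

theorem card_compl_pair_finset [Fintype P] [DecidableEq P] (p q : P) :
    (({Sum.inl p, Sum.inr q} : Finset (P ⊕ P))ᶜ).card = 2 * Fintype.card P - 2 := by
  rw [Finset.card_compl, Finset.card_pair Sum.inl_ne_inr, Fintype.card_sum, two_mul]

theorem subset_compl_pair [Fintype P] [DecidableEq P] {s : Finset (P ⊕ P)} {p q : P} (hp : Sum.inl p ∉ s)
    (hq : Sum.inr q ∉ s) : s ⊆ ({Sum.inl p, Sum.inr q} : Finset (P ⊕ P))ᶜ := by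
  intro i hi
  simp only [Finset.mem_compl, Finset.mem_insert, Finset.mem_singleton]
  rintro (rfl | rfl)
  exacts [hp hi, hq hi]

variable [PartialOrder P] [Fintype P]

/-- Since `I` is a lower set, `p ∉ I` forces `q ∉ I`, so `x_p` or `y_q` divides `u_I`. -/
theorem u_mem_span_x_y (I : LowerSet P) {p q : P} (hpq : p ≤ q) :
    u K I ∈ Ideal.span {x K p, y K q} := by
  classical
  by_cases hp : p ∈ I
  · refine Ideal.mul_mem_right _ _ (Ideal.mem_of_dvd _ (Finset.dvd_prod_of_mem _ (?_ : p ∈ _))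
      (Ideal.subset_span (by simp)))
    simpa using hp
  · refine Ideal.mul_mem_left _ _ (Ideal.mem_of_dvd _ (Finset.dvd_prod_of_mem _ (?_ : q ∈ _))
      (Ideal.subset_span (by simp)))
    simpa using fun hq => hp (I.lower hpq hq)

theorem u_dvd_monomial (I : LowerSet P) (d : P ⊕ P →₀ ℕ) (c : K)
    (hx : ∀ p ∈ I, d (Sum.inl p) ≠ 0) (hy : ∀ p ∉ I, d (Sum.inr p) ≠ 0) :
    u K I ∣ monomial d c := by
  classical
  rw [monomial_eq, Finsupp.prod_fintype _ _ (by simp), Fintype.prod_sum_type]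
  refine Dvd.dvd.mul_left (mul_dvd_mul ?_ ?_) _
  · refine (Finset.prod_dvd_prod_of_dvd _ (fun p => X (Sum.inl p) ^ d (Sum.inl p))
      fun p hp => dvd_pow_self _ (hx p ?_)).trans
      (Finset.prod_dvd_prod_of_subset _ _ _ (Finset.subset_univ _))
    simpa using hp
  · refine (Finset.prod_dvd_prod_of_dvd _ (fun p => X (Sum.inr p) ^ d (Sum.inr p))
      fun p hp => dvd_pow_self _ (hy p ?_)).trans
      (Finset.prod_dvd_prod_of_subset _ _ _ (Finset.subset_univ _))
    simpa using hp

theorem H_eq_iInf : H P K = ⨅ (p : P) (q : P) (_ : p ≤ q), Ideal.span {x K p, y K q} := by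
  apply le_antisymm
  · rw [H, Ideal.span_le]
    rintro _ ⟨I, rfl⟩
    simp only [SetLike.mem_coe, Ideal.mem_iInf]
    exact fun p q hpq => u_mem_span_x_y I hpq
  · intro m hm
    simp only [Ideal.mem_iInf, mem_span_x_y] at hm
    rw [m.as_sum]
    refine Ideal.sum_mem _ fun d hd => ?_
    -- If `p ∈ I`, then `p ≤ q` for some `q` with `y_q` absent, which forces `x_p` to occur; if `p ∉
    -- I`, then `y_p` occurs by construction.
    let I : LowerSet P := lowerClosure {q | d (Sum.inr q) = 0}
    refine Ideal.mem_of_dvd _ (u_dvd_monomial I d _ ?_ ?_) (Ideal.subset_span ⟨I, rfl⟩)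
    · rintro p ⟨q, hq, hpq⟩
      exact (hm p q hpq d hd).resolve_right (not_not.2 hq)
    · exact fun p hp h => hp (subset_lowerClosure h)

theorem exists_span_x_y_le_of_H_le {J : Ideal (MvPolynomial (P ⊕ P) K)} (hJ : J.IsPrime)
    (h : H P K ≤ J) : ∃ pq : {pq : P × P // pq.1 ≤ pq.2},
      Ideal.span {x K pq.1.1, y K pq.1.2} ≤ J := by
  refine exists_le_of_iInf_le hJ (le_trans ?_ h)
  rw [H_eq_iInf]
  exact le_iInf fun p => le_iInf fun q => le_iInf fun hpq => iInf_le_of_le ⟨(p, q), hpq⟩ le_rfl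

theorem H_le_span_x_y {p q : P} (hpq : p ≤ q) : H P K ≤ Ideal.span {x K p, y K q} := by
  rw [H_eq_iInf]
  exact iInf_le_of_le p (iInf_le_of_le q (iInf_le _ hpq))

theorem height_H [Nonempty P] : (H P K).height = 2 := by
  apply le_antisymm
  · obtain ⟨p⟩ := ‹Nonempty P›
    exact (Ideal.height_mono (H_le_span_x_y le_rfl)).trans_eq
      (height_span_pair_X (Sum.inl_ne_inr (a := p) (b := p)))
  · rw [Ideal.height_eq_inf_minimalPrimes]
    refine le_iInf₂ fun J hJ => ?_
    obtain ⟨pq, h⟩ := exists_span_x_y_le_of_H_le hJ.1.1 hJ.1.2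
    exact (height_span_pair_X Sum.inl_ne_inr).symm.le.trans (Ideal.height_mono h)

theorem ringKrullDim_quotient_H [Nonempty P] :
    ringKrullDim (MvPolynomial (P ⊕ P) K ⧸ H P K) = (2 * Fintype.card P - 2 : ℕ) := by
  have hdim (p q : P) : ringKrullDim (MvPolynomial (P ⊕ P) K ⧸ Ideal.span {x K p, y K q}) =
      (2 * Fintype.card P - 2 : ℕ) := by
    rw [span_x_y_eq, ringKrullDim_quotient_span_X_image, card_compl_pair]
  apply le_antisymm
  · exact ringKrullDim_quotient_le_of_forall_prime
      (fun J hJ h => exists_span_x_y_le_of_H_le hJ h) fun pq => (hdim _ _).le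
  · obtain ⟨p⟩ := ‹Nonempty P›
    rw [← hdim p p]
    exact ringKrullDim_le_of_surjective _
      (Ideal.Quotient.factor_surjective (H_le_span_x_y le_rfl))

open Classical in
/-- The supports of the monomials not in `H P K`. -/
noncomputable def faces (P : Type*) [PartialOrder P] [Fintype P] : Finset (Finset (P ⊕ P)) :=
  Finset.univ.filter fun s => ∃ p q : P, p ≤ q ∧ Sum.inl p ∉ s ∧ Sum.inr q ∉ s

theorem mem_faces {s : Finset (P ⊕ P)} :
    s ∈ faces P ↔ ∃ p q : P, p ≤ q ∧ Sum.inl p ∉ s ∧ Sum.inr q ∉ s := by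
  simp [faces]

theorem mem_H_iff (m : MvPolynomial (P ⊕ P) K) :
    m ∈ H P K ↔ ∀ d ∈ m.support, d.support ∉ faces P := by
  simp only [H_eq_iInf, Ideal.mem_iInf, mem_span_x_y, mem_faces, Finsupp.mem_support_iff]
  constructor
  · rintro h d hd ⟨p, q, hpq, h1, h2⟩
    exact (h p q hpq d hd).elim h1 h2
  · intro h p q hpq d hd
    by_contra! hc
    exact h d hd ⟨p, q, hpq, not_not.2 hc.1, not_not.2 hc.2⟩

variable [DecidableEq P]

theorem card_le_of_mem_faces {s : Finset (P ⊕ P)} (hs : s ∈ faces P) :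
    s.card ≤ 2 * Fintype.card P - 2 := by
  obtain ⟨p, q, -, hp, hq⟩ := mem_faces.1 hs
  exact (Finset.card_le_card (subset_compl_pair hp hq)).trans_eq (card_compl_pair_finset p q)

/-- The faces of maximal size correspond to the pairs `p ≤ q`. -/
theorem card_facets : ((faces P).filter fun s => s.card = 2 * Fintype.card P - 2).card =
    Nat.card {pq : P × P // pq.1 ≤ pq.2} := by
  classical
  rw [Nat.card_eq_fintype_card, ← Finset.card_univ]
  symm
  refine Finset.card_bij (fun pq _ => ({Sum.inl pq.1.1, Sum.inr pq.1.2} : Finset (P ⊕ P))ᶜ) ?_ ?_ ?_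
  · intro pq _
    rw [Finset.mem_filter, mem_faces]
    exact ⟨⟨pq.1.1, pq.1.2, pq.2, by simp, by simp⟩, card_compl_pair_finset _ _⟩
  · rintro ⟨⟨p, q⟩, h⟩ _ ⟨⟨p', q'⟩, h'⟩ _ heq
    have heq := compl_injective heq
    have h1 : Sum.inl p ∈ ({Sum.inl p', Sum.inr q'} : Finset (P ⊕ P)) := by
      rw [← heq]; simp
    have h2 : Sum.inr q ∈ ({Sum.inl p', Sum.inr q'} : Finset (P ⊕ P)) := by
      rw [← heq]; simp
    simp only [Finset.mem_insert, Finset.mem_singleton, Sum.inl.injEq, reduceCtorEq, or_false,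
      Sum.inr.injEq, false_or] at h1 h2
    subst h1 h2
    rfl
  · intro s hs
    rw [Finset.mem_filter, mem_faces] at hs
    obtain ⟨⟨p, q, hpq, hp, hq⟩, hcard⟩ := hs
    refine ⟨⟨(p, q), hpq⟩, Finset.mem_univ _, ?_⟩
    -- A face lies in the complement of the pair it avoids; equal cardinality makes them equal.
    exact (Finset.eq_of_subset_of_card_le (subset_compl_pair hp hq)
      ((card_compl_pair_finset p q).trans_le hcard.ge)).symm

end PosetIdeal

end PosetIdeal

theorem proposition2p4 (P : Type*) [PartialOrder P] [Fintype P] [Nonempty P]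
    (K : Type*) [Field K] :
    (PosetIdeal.H P K).height = 2 ∧
    (∀ p q : P, p ≤ q → (Ideal.span {PosetIdeal.x K p, PosetIdeal.y K q}).IsPrime) ∧
    PosetIdeal.H P K =
      ⨅ (p : P) (q : P) (_ : p ≤ q), Ideal.span {PosetIdeal.x K p, PosetIdeal.y K q} ∧
    PosetIdeal.IsMultiplicity (PosetIdeal.H P K) (Nat.card {pq : P × P // pq.1 ≤ pq.2}) := by
  classical
  refine ⟨PosetIdeal.height_H, fun p q _ => ?_, PosetIdeal.H_eq_iInf, ?_⟩
  · rw [PosetIdeal.span_x_y_eq]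
    exact PosetIdeal.isPrime_span_X_image _
  · rw [← PosetIdeal.card_facets]
    exact PosetIdeal.isMultiplicity_card PosetIdeal.mem_H_iff
      (fun _ => PosetIdeal.card_le_of_mem_faces) PosetIdeal.ringKrullDim_quotient_H
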